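/- For a complex number $x$ and an integer $n\ge 0$ let $(x)_n=x(x+1)\cdots(x+n-1)$, with $(x)_0=1$; for complex $k$ let $(x)_k=\Gamma(x+k)/\Gamma(x)$, wherever this is defined. Then for every complex number $k$ with $\operatorname{Re}k>-\tfrac18$ the series on the left-hand side below converges (possibly only conditionally, as the limit of its partial sums) and $$\sum_{n=0}^{\infty}(-1)^n\,\frac{\left(\frac12-k\right)_n^2\left(\frac12\right)_n}{(1+k)_n^2\,(1)_n}\,(4n+1)=\frac{2}{\pi}\left(\frac14\right)^{k}\frac{(1)_k^2}{\left(\frac14\right)_k\left(\frac34\right)_k},$$ where $(1/4)^k=e^{-k\ln 4}$. In particular, for $k=0$, $$\sum_{n=0}^{\infty}(-1)^n\,\frac{\left(\frac12\right)_n^3}{(1)_n^3}\,(4n+1)=\frac{2}{\pi}.$$ -/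

import Mathlib

open Filter Topology

noncomputable section

/-- The rising factorial `(x)_n = x (x+1) ⋯ (x+n-1)` with `(x)_0 = 1`, for `n` a natural number. -/
def risingFactorial (x : ℂ) (n : ℕ) : ℂ :=
  (ascPochhammer ℂ n).eval x

/-- The Pochhammer symbol `(x)_k = Γ(x+k) / Γ(x)` with complex `k`. -/
def pochhammerSymbol (x k : ℂ) : ℂ :=
  Complex.Gamma (x + k) / Complex.Gamma x

end

/-! The series is half of a very-well-poised `₄F₃(-1)` with a = 1/2, b = c = 1/2 - k, since 4n + 1 =
2(a + 2n). It is summed in three moves. A telescoping relation in a further parameter d yields, at d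
= -m, the terminating `₅F₄(1)` sum by induction on m. As m → ∞ the d-factor tends to (-1)^n, and
dominated convergence gives the alternating sum where it converges absolutely, Re(2b + 2c - a) < 1.
A second telescoping relation, in b, carries the result to Re(2b + 2c - a) < 2, which here is Re k >
-1/8. The Gamma quotient obtained is put in the stated form by Legendre duplication. -/

/-! ### Rising factorials -/

theorem risingFactorial_zero (x : ℂ) : risingFactorial x 0 = 1 := by
  simp [risingFactorial]

theorem risingFactorial_succ (x : ℂ) (n : ℕ) :
    risingFactorial x (n + 1) = risingFactorial x n * (x + n) :=
  ascPochhammer_succ_eval n x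

theorem risingFactorial_succ_left (x : ℂ) (n : ℕ) :
    risingFactorial x (n + 1) = x * risingFactorial (x + 1) n := by
  simp [risingFactorial, ascPochhammer_succ_left]

theorem risingFactorial_one (n : ℕ) : risingFactorial 1 n = (n.factorial : ℂ) :=
  ascPochhammer_eval_one ℂ n

theorem risingFactorial_eq_prod (x : ℂ) (n : ℕ) :
    risingFactorial x n = ∏ j ∈ Finset.range n, (x + j) := by
  induction n with
  | zero => simp [risingFactorial_zero]
  | succ n ih => rw [risingFactorial_succ, ih, Finset.prod_range_succ]

theorem add_natCast_ne_zero {x : ℂ} (hx : ∀ j : ℕ, x ≠ -j) (n : ℕ) : x + n ≠ 0 :=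
  fun h => hx n (eq_neg_of_add_eq_zero_left h)

theorem risingFactorial_ne_zero {x : ℂ} (hx : ∀ j : ℕ, x ≠ -j) (n : ℕ) :
    risingFactorial x n ≠ 0 := by
  rw [risingFactorial_eq_prod]
  exact Finset.prod_ne_zero_iff.2 fun j _ => add_natCast_ne_zero hx j

theorem risingFactorial_neg_natCast {m n : ℕ} (h : m < n) : risingFactorial (-(m : ℂ)) n = 0 := by
  rw [risingFactorial_eq_prod]
  exact Finset.prod_eq_zero (Finset.mem_range.2 h) (neg_add_cancel _)

theorem ne_neg_natCast_of_re_pos {x : ℂ} (hx : 0 < x.re) (j : ℕ) : x ≠ -j := by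
  rintro rfl
  simp only [Complex.neg_re, Complex.natCast_re] at hx
  linarith [(Nat.cast_nonneg j : (0 : ℝ) ≤ j)]

theorem add_one_ne_neg_natCast {x : ℂ} (hx : ∀ j : ℕ, x ≠ -j) (j : ℕ) : x + 1 ≠ -j := by
  intro h
  apply hx (j + 1)
  push_cast
  linear_combination h

/-! ### Telescoping relations and the terminating sum -/

/-- The well-poised factor
`(a)_n (b)_n (c)_n / (n! (1 + a - b)_n (1 + a - c)_n)`. -/
noncomputable def wellPoised (a b c : ℂ) (n : ℕ) : ℂ :=
  risingFactorial a n * risingFactorial b n * risingFactorial c n /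
    (n.factorial * risingFactorial (1 + a - b) n * risingFactorial (1 + a - c) n)

theorem wellPoised_zero (a b c : ℂ) : wellPoised a b c 0 = 1 := by
  simp [wellPoised, risingFactorial_zero]

theorem wellPoised_succ (a b c : ℂ) (n : ℕ) :
    wellPoised a b c (n + 1) = wellPoised a b c n *
      ((a + n) * (b + n) * (c + n) / ((n + 1) * (1 + a - b + n) * (1 + a - c + n))) := by
  simp only [wellPoised, risingFactorial_succ, Nat.factorial_succ]
  rw [div_mul_div_comm]
  push_cast
  congr 1 <;> ring

/-- The telescoping identity behind the parameter shift `d → d + 1` in the very-well-poised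
`₅F₄` series. -/
theorem sum_wellPoised_shift {a b c d : ℂ} (hb : ∀ j : ℕ, 1 + a - b ≠ -j)
    (hc : ∀ j : ℕ, 1 + a - c ≠ -j) (hd : ∀ j : ℕ, a - d ≠ -j) (N : ℕ) :
    ∑ n ∈ Finset.range (N + 1),
      ((a - d - b) * (a - d - c) * (wellPoised a b c n *
          (risingFactorial d n / risingFactorial (1 + a - d) n) * (a + 2 * n)) -
        (a - d) * (a - d - b - c) * (wellPoised a b c n *
          (risingFactorial (d + 1) n / risingFactorial (a - d) n) * (a + 2 * n))) =
      wellPoised a b c N * (a + N) * (b + N) * (c + N) *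
        (risingFactorial (d + 1) N / risingFactorial (1 + a - d) N) := by
  have e1 : a - d + 1 = 1 + a - d := by ring
  have hd0 : a - d ≠ 0 := by simpa using hd 0
  have hd1 : ∀ j : ℕ, 1 + a - d ≠ -j := by
    intro j; rw [← e1]; exact add_one_ne_neg_natCast hd j
  induction N with
  | zero =>
    simp [wellPoised_zero, risingFactorial_zero]
    ring
  | succ N ih =>
    -- Peeling the first factor of (d)_{N+1} and (a-d)_{N+1} leaves only (d+1)_N and (1+a-d)_N, so
    -- the claim becomes a rational identity.
    rw [Finset.sum_range_succ, ih, wellPoised_succ, risingFactorial_succ_left d,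
      risingFactorial_succ_left (a - d), e1, risingFactorial_succ, risingFactorial_succ]
    have h1 := add_natCast_ne_zero hb N
    have h2 := add_natCast_ne_zero hc N
    have h3 := add_natCast_ne_zero hd1 N
    have h4 : (N : ℂ) + 1 ≠ 0 := Nat.cast_add_one_ne_zero N
    have h5 := risingFactorial_ne_zero hd1 N
    generalize wellPoised a b c N = w
    generalize risingFactorial (d + 1) N = p at *
    generalize risingFactorial (1 + a - d) N = q at *
    push_cast
    field_simp
    ring

/-- The telescoping identity behind the parameter shift `b → b + 1` in the very-well-poised
`₄F₃(-1)` series. -/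
theorem sum_alternating_wellPoised_shift {a b c : ℂ} (hb : ∀ j : ℕ, a - b ≠ -j)
    (hc : ∀ j : ℕ, 1 + a - c ≠ -j) (N : ℕ) :
    ∑ n ∈ Finset.range (N + 1),
      ((a - b - c) * ((-1) ^ n * wellPoised a b c n * (a + 2 * n)) -
        (a - b) * ((-1) ^ n * wellPoised a (b + 1) c n * (a + 2 * n))) =
      -((-1) ^ N * wellPoised a (b + 1) c N * ((a + N) * (c + N) * (a - b) / (a - b + N))) := by
  have e : 1 + a - (b + 1) = a - b := by ring
  have hb0 : a - b ≠ 0 := by simpa using hb 0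
  have key (n : ℕ) : wellPoised a b c (n + 1) = wellPoised a (b + 1) c n *
      (a + n) * (c + n) * b * (a - b) / ((n + 1) * (a - b + n) * (a - b + n + 1) * (1 + a - c + n))
      := by
    have e1 : a - b + 1 = 1 + a - b := by ring
    have h0 := risingFactorial_ne_zero hb n
    have h2 := risingFactorial_ne_zero hc n
    have h3 := add_natCast_ne_zero hb n
    have h4 := add_natCast_ne_zero hb (n + 1)
    have h5 := add_natCast_ne_zero hc n
    have h6 : (n : ℂ) + 1 ≠ 0 := Nat.cast_add_one_ne_zero n
    have h7 : (n.factorial : ℂ) ≠ 0 := by exact_mod_cast n.factorial_ne_zero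
    push_cast at h4
    have h8 : risingFactorial (1 + a - b) (n + 1) =
        risingFactorial (a - b) n * (a - b + n) * (a - b + n + 1) / (a - b) := by
      rw [eq_div_iff hb0, mul_comm, ← e1, ← risingFactorial_succ_left, risingFactorial_succ,
        risingFactorial_succ]
      push_cast
      ring
    rw [wellPoised, wellPoised, h8, e, risingFactorial_succ_left b, risingFactorial_succ a,
      risingFactorial_succ c, risingFactorial_succ (1 + a - c), Nat.factorial_succ]
    have h9 : a - b + (n + 1) ≠ 0 := h4
    rw [← add_assoc] at h9
    push_cast
    field_simp
  induction N with
  | zero =>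
    simp [wellPoised_zero]
    field_simp
    ring
  | succ N ih =>
    rw [Finset.sum_range_succ, ih, key, wellPoised_succ, e]
    have h2 := add_natCast_ne_zero hc N
    have h3 := add_natCast_ne_zero hb N
    have h4 := add_natCast_ne_zero hb (N + 1)
    have h6 : (N : ℂ) + 1 ≠ 0 := Nat.cast_add_one_ne_zero N
    push_cast at h4 ⊢
    have h9 := h4
    rw [← add_assoc] at h9
    generalize wellPoised a (b + 1) c N = w
    rw [pow_succ]
    generalize (-1 : ℂ) ^ N = s
    field_simp
    ring

/-- The terminating very-well-poised `₅F₄(1)` summation. -/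
theorem sum_terminating_wellPoised {a b c : ℂ} (ha : 0 < a.re) (hb : ∀ j : ℕ, 1 + a - b ≠ -j)
    (hc : ∀ j : ℕ, 1 + a - c ≠ -j) (m : ℕ) :
    ∑ n ∈ Finset.range (m + 1), wellPoised a b c n *
      (risingFactorial (-m) n / risingFactorial (1 + a + m) n) * (a + 2 * n) =
      a * (risingFactorial (1 + a) m * risingFactorial (1 + a - b - c) m /
        (risingFactorial (1 + a - b) m * risingFactorial (1 + a - c) m)) := by
  induction m with
  | zero => simp [risingFactorial_zero, wellPoised_zero]
  | succ m ih =>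
    have hd (j : ℕ) : a - (-((m + 1 : ℕ) : ℂ)) ≠ -j := by
      apply ne_neg_natCast_of_re_pos
      rw [sub_neg_eq_add, Complex.add_re, Complex.natCast_re]
      positivity
    -- With d = -(m+1) the shift links the sums for m + 1 and m. The boundary term and the extra
    -- term of the shorter sum both contain (-m)_{m+1} = 0.
    have h := sum_wellPoised_shift hb hc hd (m + 1)
    have e1 : -((m + 1 : ℕ) : ℂ) + 1 = -(m : ℂ) := by push_cast; ring
    have e2 : a - (-((m + 1 : ℕ) : ℂ)) = 1 + a + m := by push_cast; ring
    have e3 : 1 + a - (-((m + 1 : ℕ) : ℂ)) = 1 + a + (m + 1 : ℕ) := by ring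
    rw [Finset.sum_sub_distrib, ← Finset.mul_sum, ← Finset.mul_sum, e1, e2, e3,
      Finset.sum_range_succ (fun n => wellPoised a b c n *
        (risingFactorial (-m) n / risingFactorial (1 + a + m) n) * (a + 2 * n)), ih,
      risingFactorial_neg_natCast (Nat.lt_succ_self m)] at h
    have h1 := add_natCast_ne_zero hb m
    have h2 := add_natCast_ne_zero hc m
    have h3 := risingFactorial_ne_zero hb m
    have h4 := risingFactorial_ne_zero hc m
    have h5 : 1 + a + m - b ≠ 0 := by convert h1 using 1; ring
    have h6 : 1 + a + m - c ≠ 0 := by convert h2 using 1; ring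
    simp only [risingFactorial_succ]
    simp only [zero_div, mul_zero, add_zero, zero_mul] at h
    apply mul_left_cancel₀ (mul_ne_zero h5 h6)
    rw [sub_eq_zero.1 h]
    field_simp
    ring

/-! ### Asymptotics and bounds -/

/-- Euler's limit for Gamma, inverted: (x)_n ~ n! n^(x-1) / Γ(x). -/
theorem tendsto_risingFactorial (x : ℂ) :
    Tendsto (fun n : ℕ => risingFactorial x n * (n : ℂ) ^ (1 - x) / n.factorial) atTop
      (𝓝 (Complex.Gamma x)⁻¹) := by
  by_cases hx : ∀ j : ℕ, x ≠ -j
  · have h1 := (Complex.GammaSeq_tendsto_Gamma x).inv₀ (Complex.Gamma_ne_zero hx)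
    have h2 : Tendsto (fun n : ℕ => (n : ℂ) / (n + x)) atTop (𝓝 1) :=
      tendsto_natCast_div_add_atTop x
    have h3 := h1.mul h2
    rw [mul_one] at h3
    refine h3.congr' ?_
    filter_upwards [eventually_ne_atTop 0] with n hn
    have hn' : (n : ℂ) ≠ 0 := Nat.cast_ne_zero.2 hn
    have h4 := add_natCast_ne_zero hx n
    rw [Complex.GammaSeq, ← risingFactorial_eq_prod, risingFactorial_succ,
      Complex.cpow_sub _ _ hn', Complex.cpow_one, inv_div, add_comm (n : ℂ) x]
    field_simp
  -- At a pole both sides vanish, as `Complex.Gamma` and `0⁻¹` are 0 by convention.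
  · push Not at hx
    obtain ⟨j, rfl⟩ := hx
    rw [Complex.Gamma_neg_nat_eq_zero, inv_zero]
    refine tendsto_const_nhds.congr' ?_
    filter_upwards [eventually_gt_atTop j] with n hn
    rw [risingFactorial_neg_natCast hn, zero_mul, zero_div]

theorem wellPoised_isBigO {a b c : ℂ} (hb : ∀ j : ℕ, 1 + a - b ≠ -j)
    (hc : ∀ j : ℕ, 1 + a - c ≠ -j) :
    wellPoised a b c =O[atTop] fun n : ℕ => (n : ℝ) ^ ((2 * b + 2 * c - a).re - 3) := by
  have hy := (tendsto_risingFactorial (1 + a - b)).inv₀ (inv_ne_zero (Complex.Gamma_ne_zero hb))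
  have hz := (tendsto_risingFactorial (1 + a - c)).inv₀ (inv_ne_zero (Complex.Gamma_ne_zero hc))
  have h := ((((tendsto_risingFactorial a).mul (tendsto_risingFactorial b)).mul
    (tendsto_risingFactorial c)).mul hy).mul hz
  have h' := (h.isBigO_one ℂ).mul (Asymptotics.isBigO_refl
    (fun n : ℕ => (n : ℂ) ^ (2 * b + 2 * c - a - 3)) atTop)
  refine (h'.congr' ?_ EventuallyEq.rfl).trans (Asymptotics.IsBigO.of_norm_eventuallyLE ?_)
  · filter_upwards [eventually_ne_atTop 0] with n hn
    have hn' : (n : ℂ) ≠ 0 := Nat.cast_ne_zero.2 hn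
    have h1 := risingFactorial_ne_zero hb n
    have h2 := risingFactorial_ne_zero hc n
    have h3 : (n.factorial : ℂ) ≠ 0 := by exact_mod_cast n.factorial_ne_zero
    have ha0 : (n : ℂ) ^ a ≠ 0 := by simp [Complex.cpow_eq_zero_iff, hn]
    have hb0 : (n : ℂ) ^ b ≠ 0 := by simp [Complex.cpow_eq_zero_iff, hn]
    have hc0 : (n : ℂ) ^ c ≠ 0 := by simp [Complex.cpow_eq_zero_iff, hn]
    have e3 : (n : ℂ) ^ (3 : ℂ) = (n : ℂ) ^ 3 := by exact_mod_cast Complex.cpow_natCast (n : ℂ) 3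
    rw [wellPoised]
    simp only [Complex.cpow_sub _ _ hn', Complex.cpow_add _ _ hn', Complex.cpow_one, two_mul, e3]
    field_simp
  · filter_upwards [eventually_ne_atTop 0] with n hn
    rw [one_mul, Complex.norm_natCast_cpow_of_pos (Nat.pos_of_ne_zero hn)]
    simp

theorem const_isBigO_natCast (a : ℂ) : (fun _ : ℕ => a) =O[atTop] fun n : ℕ => (n : ℝ) := by
  refine Asymptotics.IsBigO.of_bound ‖a‖ ?_
  filter_upwards [eventually_ge_atTop 1] with n hn
  rw [Real.norm_natCast]
  exact le_mul_of_one_le_right (norm_nonneg a) (by exact_mod_cast hn)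

theorem add_natCast_isBigO (a : ℂ) :
    (fun n : ℕ => a + n) =O[atTop] fun n : ℕ => (n : ℝ) :=
  (const_isBigO_natCast a).add (Asymptotics.IsBigO.of_norm_le fun n => by simp)

theorem add_two_mul_isBigO (a : ℂ) :
    (fun n : ℕ => a + 2 * n) =O[atTop] fun n : ℕ => (n : ℝ) :=
  (const_isBigO_natCast a).add
    ((Asymptotics.IsBigO.of_norm_le fun n => by simp :
      (fun n : ℕ => (n : ℂ)) =O[atTop] fun n : ℕ => (n : ℝ)).const_mul_left 2)

/-- Factor by factor, m - j ≤ Re(1 + a + m + j). This gives a dominating bound uniform in m. -/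
theorem norm_risingFactorial_neg_le {a : ℂ} (ha : 0 < a.re) (m n : ℕ) :
    ‖risingFactorial (-m) n‖ ≤ ‖risingFactorial (1 + a + m) n‖ := by
  rcases lt_or_ge m n with h | h
  · rw [risingFactorial_neg_natCast h, norm_zero]
    exact norm_nonneg _
  · simp only [risingFactorial_eq_prod, norm_prod]
    refine Finset.prod_le_prod (fun _ _ => norm_nonneg _) fun j hj => ?_
    have hjm : (j : ℝ) ≤ m := by exact_mod_cast (Finset.mem_range.1 hj).le.trans h
    have e : (-(m : ℂ) + j) = ((j - m : ℝ) : ℂ) := by push_cast; ring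
    rw [e, Complex.norm_real, Real.norm_of_nonpos (by linarith)]
    refine le_trans ?_ (Complex.re_le_norm _)
    simp only [Complex.add_re, Complex.one_re, Complex.natCast_re]
    linarith [(Nat.cast_nonneg j : (0 : ℝ) ≤ j)]

theorem tendsto_risingFactorial_neg_div (x : ℂ) (n : ℕ) :
    Tendsto (fun m : ℕ => risingFactorial (-m) n / risingFactorial (x + m) n) atTop
      (𝓝 ((-1) ^ n)) := by
  simp only [risingFactorial_eq_prod, ← Finset.prod_div_distrib]
  rw [← Finset.card_range n, ← Finset.prod_const, Finset.card_range]
  refine tendsto_finsetProd _ fun j _ => ?_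
  have h1 := tendsto_natCast_div_add_atTop (x + j)
  have h2 := (tendsto_inv_atTop_nhds_zero_nat (𝕜 := ℂ)).const_mul (j : ℂ)
  rw [mul_zero] at h2
  have h3 := h1.mul (h2.sub_const 1)
  rw [zero_sub, one_mul] at h3
  refine h3.congr' ?_
  filter_upwards [eventually_ne_atTop 0] with m hm
  have hm' : (m : ℂ) ≠ 0 := Nat.cast_ne_zero.2 hm
  rw [show x + m + (j : ℂ) = m + (x + j) by ring]
  field_simp
  ring

/-- The balance u + v = y + z makes the powers of m cancel, leaving only Gamma values. -/
theorem tendsto_risingFactorial_quotient {u v y z : ℂ} (hy : ∀ j : ℕ, y ≠ -j)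
    (hz : ∀ j : ℕ, z ≠ -j) (h : u + v = y + z) :
    Tendsto (fun m : ℕ => risingFactorial u m * risingFactorial v m /
      (risingFactorial y m * risingFactorial z m)) atTop
      (𝓝 (Complex.Gamma y * Complex.Gamma z / (Complex.Gamma u * Complex.Gamma v))) := by
  have hy' := (tendsto_risingFactorial y).inv₀ (inv_ne_zero (Complex.Gamma_ne_zero hy))
  have hz' := (tendsto_risingFactorial z).inv₀ (inv_ne_zero (Complex.Gamma_ne_zero hz))
  have H := ((tendsto_risingFactorial u).mul (tendsto_risingFactorial v)).mul (hy'.mul hz')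
  convert H.congr' ?_ using 2
  · simp only [inv_inv, div_eq_mul_inv, mul_inv]
    ring
  · filter_upwards [eventually_ne_atTop 0] with n hn
    have hn' : (n : ℂ) ≠ 0 := Nat.cast_ne_zero.2 hn
    have h1 := risingFactorial_ne_zero hy n
    have h2 := risingFactorial_ne_zero hz n
    have h3 : (n.factorial : ℂ) ≠ 0 := by exact_mod_cast n.factorial_ne_zero
    have hy0 : (n : ℂ) ^ (1 - y) ≠ 0 := by simp [Complex.cpow_eq_zero_iff, hn]
    have hz0 : (n : ℂ) ^ (1 - z) ≠ 0 := by simp [Complex.cpow_eq_zero_iff, hn]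
    have e : (n : ℂ) ^ (1 - u) * (n : ℂ) ^ (1 - v) = (n : ℂ) ^ (1 - y) * (n : ℂ) ^ (1 - z) := by
      rw [← Complex.cpow_add _ _ hn', ← Complex.cpow_add _ _ hn']
      congr 1
      linear_combination -h
    field_simp
    linear_combination (risingFactorial u n * risingFactorial v n) * e

theorem summable_wellPoised {a b c : ℂ} (hb : ∀ j : ℕ, 1 + a - b ≠ -j)
    (hc : ∀ j : ℕ, 1 + a - c ≠ -j) (h : (2 * b + 2 * c - a).re < 1) :
    Summable fun n : ℕ => ‖wellPoised a b c n * (a + 2 * n)‖ := by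
  have h1 := (wellPoised_isBigO hb hc).mul (add_two_mul_isBigO a)
  have h2 : (fun n : ℕ => wellPoised a b c n * (a + 2 * n)) =O[atTop]
      fun n : ℕ => (n : ℝ) ^ ((2 * b + 2 * c - a).re - 2) := by
    refine h1.congr' EventuallyEq.rfl ?_
    filter_upwards [eventually_gt_atTop 0] with n hn
    have hn' : (0 : ℝ) < n := Nat.cast_pos.2 hn
    rw [← Real.rpow_add_one hn'.ne']
    ring_nf
  exact summable_of_isBigO_nat (Real.summable_nat_rpow.2 (by linarith)) h2.norm_left

/-! ### The alternating sum -/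

/-- The very-well-poised `₄F₃(-1)` summation in the region of absolute convergence. -/
theorem tsum_alternating_wellPoised {a b c : ℂ} (ha : 0 < a.re) (hb : ∀ j : ℕ, 1 + a - b ≠ -j)
    (hc : ∀ j : ℕ, 1 + a - c ≠ -j) (h : (2 * b + 2 * c - a).re < 1) :
    ∑' n : ℕ, (-1) ^ n * wellPoised a b c n * (a + 2 * n) =
      a * (Complex.Gamma (1 + a - b) * Complex.Gamma (1 + a - c) /
        (Complex.Gamma (1 + a) * Complex.Gamma (1 + a - b - c))) := by
  have h1 := (tendsto_risingFactorial_quotient hb hc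
    (u := 1 + a) (v := 1 + a - b - c) (by ring)).const_mul a
  refine tendsto_nhds_unique ?_ h1
  simp only [← sum_terminating_wellPoised ha hb hc]
  have h2 (m : ℕ) : ∑ n ∈ Finset.range (m + 1), wellPoised a b c n *
      (risingFactorial (-m) n / risingFactorial (1 + a + m) n) * (a + 2 * n) =
      ∑' n : ℕ, wellPoised a b c n *
      (risingFactorial (-m) n / risingFactorial (1 + a + m) n) * (a + 2 * n) := by
    refine (tsum_eq_sum fun n hn => ?_).symm
    rw [risingFactorial_neg_natCast (not_lt.1 (Finset.mem_range.not.1 hn))]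
    simp
  simp only [h2]
  refine tendsto_tsum_of_dominated_convergence (summable_wellPoised hb hc h) (fun n => ?_)
    (Eventually.of_forall fun m n => ?_)
  · rw [mul_comm ((-1) ^ n)]
    exact ((tendsto_risingFactorial_neg_div (1 + a) n).const_mul _).mul_const _
  · rw [mul_right_comm, norm_mul]
    refine mul_le_of_le_one_right (norm_nonneg _) ?_
    rw [norm_div]
    exact div_le_one_of_le₀ (norm_risingFactorial_neg_le ha m n) (norm_nonneg _)

/-- The very-well-poised `₄F₃(-1)` summation in the full region of (conditional) convergence. -/
theorem tendsto_sum_alternating_wellPoised {a b c : ℂ} (ha : 0 < a.re)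
    (hb : ∀ j : ℕ, 1 + a - b ≠ -j) (hc : ∀ j : ℕ, 1 + a - c ≠ -j)
    (h : (2 * b + 2 * c - a).re < 2) :
    Tendsto (fun N : ℕ => ∑ n ∈ Finset.range N, (-1) ^ n * wellPoised a b c n * (a + 2 * n)) atTop
      (𝓝 (a * (Complex.Gamma (1 + a - b) * Complex.Gamma (1 + a - c) /
        (Complex.Gamma (1 + a) * Complex.Gamma (1 + a - b - c))))) := by
  -- Replacing b by d = b - 1 lowers 2b + 2c - a by 2, into the region of absolute convergence.
  obtain ⟨d, rfl⟩ : ∃ d, b = d + 1 := ⟨b - 1, by ring⟩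
  have e1 : 1 + a - (d + 1) = a - d := by ring
  have e2 : a - d + 1 = 1 + a - d := by ring
  have hd0 : a - d ≠ 0 := by simpa [e1] using hb 0
  have hd : ∀ j : ℕ, 1 + a - d ≠ -j := by
    intro j
    rw [← e2, ← e1]
    exact add_one_ne_neg_natCast hb j
  have h' : (2 * d + 2 * c - a).re < 1 := by
    simp only [Complex.sub_re, Complex.add_re, Complex.mul_re, Complex.one_re, Complex.re_ofNat,
      Complex.im_ofNat, zero_mul, sub_zero] at h ⊢
    linarith
  have hs : Summable fun n : ℕ => (-1) ^ n * wellPoised a d c n * (a + 2 * n) := by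
    refine Summable.of_norm ((summable_wellPoised hd hc h').congr fun n => ?_)
    simp
  have hlim := (tendsto_add_atTop_iff_nat 1).2 hs.hasSum.tendsto_sum_nat
  rw [tsum_alternating_wellPoised ha hd hc h'] at hlim
  have hO := (wellPoised_isBigO hb hc).mul (add_natCast_isBigO c)
  -- The boundary term has order n^(Re(2b+2c-a)-2), which is where the bound 2 enters.
  have hO' : Tendsto (fun n : ℕ => wellPoised a (d + 1) c n * (c + n)) atTop (𝓝 0) := by
    refine hO.trans_tendsto ((tendsto_rpow_neg_atTop
      (y := 2 - (2 * (d + 1) + 2 * c - a).re) (by linarith)).comp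
      tendsto_natCast_atTop_atTop |>.congr' ?_)
    filter_upwards [eventually_gt_atTop 0] with n hn
    have hn' : (0 : ℝ) < n := Nat.cast_pos.2 hn
    rw [Function.comp_apply, ← Real.rpow_add_one hn'.ne']
    ring_nf
  have hq : Tendsto (fun n : ℕ => (a + n) / (a - d + n)) atTop (𝓝 1) := by
    have := (tendsto_natCast_div_add_atTop (a - d)).add
      ((tendsto_natCast_div_add_atTop (a - d)).mul
        ((tendsto_inv_atTop_nhds_zero_nat (𝕜 := ℂ)).const_mul a))
    rw [mul_zero, mul_zero, add_zero] at this
    refine this.congr' ?_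
    filter_upwards [eventually_ne_atTop 0] with m hm
    have hm' : (m : ℂ) ≠ 0 := Nat.cast_ne_zero.2 hm
    rw [add_comm (m : ℂ) (a - d)]
    field_simp
    ring
  have hG : Tendsto (fun N : ℕ => (-1) ^ N * wellPoised a (d + 1) c N *
      ((a + N) * (c + N) * (a - d) / (a - d + N))) atTop (𝓝 0) := by
    have h0 := (hO'.mul hq).mul_const (a - d)
    rw [zero_mul, zero_mul] at h0
    refine squeeze_zero_norm (fun N => le_of_eq ?_) (tendsto_zero_iff_norm_tendsto_zero.1 h0)
    simp only [norm_mul, norm_div, norm_pow, norm_neg, norm_one, one_pow]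
    ring
  have e4 : 1 + a - d - c = a - d - c + 1 := by ring
  refine (tendsto_add_atTop_iff_nat 1).1 ?_
  have hfin := ((hlim.const_mul (a - d - c)).add hG).div_const (a - d)
  convert hfin using 1
  · ext N
    have := sum_alternating_wellPoised_shift (a := a) (b := d) (c := c)
      (by simpa only [e1] using hb) hc N
    rw [Finset.sum_sub_distrib, ← Finset.mul_sum, ← Finset.mul_sum] at this
    rw [eq_div_iff hd0]
    linear_combination -this
  · rw [e1, e4, ← e2, Complex.Gamma_add_one _ hd0]
    -- The reciprocal form of the recurrence also holds when a - d - c is a pole of Γ.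
    have := Complex.one_div_Gamma_eq_self_mul_one_div_Gamma_add_one (a - d - c)
    simp only [div_eq_mul_inv, mul_inv, this, add_zero]
    field_simp


/-! ### Specialization -/

/-- Duplication at 1/4 and at 1/4 + k; the ratio of their powers of 2 supplies (1/4)^k. -/
theorem gamma_quotient_eq {k : ℂ} (hk : -(1 / 8 : ℝ) < k.re) :
    Complex.Gamma (1 + k) ^ 2 / (Complex.Gamma (3 / 2) * Complex.Gamma (1 / 2 + 2 * k)) =
      2 / (Real.pi : ℂ) * (1 / 4 : ℂ) ^ k * (pochhammerSymbol 1 k ^ 2 /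
        (pochhammerSymbol (1 / 4) k * pochhammerSymbol (3 / 4) k)) := by
  have hpi : (Real.pi : ℂ) ≠ 0 := Complex.ofReal_ne_zero.2 Real.pi_ne_zero
  have hs : ((√Real.pi : ℝ) : ℂ) ^ 2 = Real.pi := by
    rw [← Complex.ofReal_pow, Real.sq_sqrt Real.pi_pos.le]
  have hs0 : ((√Real.pi : ℝ) : ℂ) ≠ 0 := by
    intro h; rw [h] at hs; exact hpi (by rw [← hs]; ring)
  have h32 : Complex.Gamma (3 / 2) = (√Real.pi : ℝ) / 2 := by
    rw [show (3 / 2 : ℂ) = 1 / 2 + 1 by norm_num, Complex.Gamma_add_one _ (by norm_num),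
      Complex.Gamma_one_half_eq, Real.sqrt_eq_rpow, Complex.ofReal_cpow Real.pi_pos.le]
    push_cast
    ring
  have h2 : Complex.Gamma (1 / 2) = (√Real.pi : ℝ) := by
    rw [Complex.Gamma_one_half_eq, Real.sqrt_eq_rpow, Complex.ofReal_cpow Real.pi_pos.le]
    push_cast
    ring
  have d0 := Complex.Gamma_mul_Gamma_add_half (1 / 4)
  have dk := Complex.Gamma_mul_Gamma_add_half (1 / 4 + k)
  rw [show (1 / 4 + 1 / 2 : ℂ) = 3 / 4 by norm_num, show (2 * (1 / 4) : ℂ) = 1 / 2 by norm_num,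
    h2] at d0
  rw [show (1 / 4 + k + 1 / 2 : ℂ) = 3 / 4 + k by ring,
    show (2 * (1 / 4 + k) : ℂ) = 1 / 2 + 2 * k by ring,
    show (1 - (1 / 2 + 2 * k) : ℂ) = (1 - 1 / 2) - 2 * k by ring,
    Complex.cpow_sub _ _ (by norm_num : (2 : ℂ) ≠ 0)] at dk
  have h4 : (1 / 4 : ℂ) ^ k * (2 : ℂ) ^ (2 * k) = 1 := by
    have h1 := Complex.mul_cpow_ofReal_nonneg (by norm_num : (0 : ℝ) ≤ 1 / 4)
      (by norm_num : (0 : ℝ) ≤ 2) k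
    have h2 := Complex.mul_cpow_ofReal_nonneg (by norm_num : (0 : ℝ) ≤ 1 / 2)
      (by norm_num : (0 : ℝ) ≤ 2) k
    norm_num at h1 h2
    rw [Complex.cpow_ofNat_mul, sq, ← mul_assoc, ← h1, ← h2]
  have g0 : Complex.Gamma (1 / 2 + 2 * k) ≠ 0 := by
    apply Complex.Gamma_ne_zero_of_re_pos
    simp
    linarith
  have g1 : Complex.Gamma (1 / 4 + k) ≠ 0 := by
    apply Complex.Gamma_ne_zero_of_re_pos
    simp
    linarith
  have g2 : Complex.Gamma (3 / 4 + k) ≠ 0 := by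
    apply Complex.Gamma_ne_zero_of_re_pos
    simp
    linarith
  have hp : (2 : ℂ) ^ (2 * k) ≠ 0 := by simp [Complex.cpow_eq_zero_iff]
  have hr : (2 : ℂ) ^ (1 - 1 / 2 : ℂ) ≠ 0 := by simp [Complex.cpow_eq_zero_iff]
  have h4' : (1 / 4 : ℂ) ^ k = ((2 : ℂ) ^ (2 * k))⁻¹ := eq_inv_of_mul_eq_one_left h4
  have e : pochhammerSymbol 1 k ^ 2 / (pochhammerSymbol (1 / 4) k * pochhammerSymbol (3 / 4) k) =
      Complex.Gamma (1 + k) ^ 2 * (Complex.Gamma (1 / 4) * Complex.Gamma (3 / 4)) /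
        (Complex.Gamma (1 / 4 + k) * Complex.Gamma (3 / 4 + k)) := by
    rw [pochhammerSymbol, pochhammerSymbol, pochhammerSymbol, Complex.Gamma_one, div_one,
      div_mul_div_comm, div_div_eq_mul_div]
  rw [e, d0, dk, h4', h32, ← hs]
  field_simp

theorem mainTheorem9 :
    (∀ k : ℂ, -(1 / 8 : ℝ) < k.re →
      Tendsto
        (fun N : ℕ => ∑ n ∈ Finset.range N,
          (-1 : ℂ) ^ n *
            (risingFactorial (1 / 2 - k) n ^ 2 * risingFactorial (1 / 2) n /
              (risingFactorial (1 + k) n ^ 2 * risingFactorial 1 n)) *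
            (4 * (n : ℂ) + 1))
        atTop
        (𝓝 (2 / (Real.pi : ℂ) * (1 / 4 : ℂ) ^ k *
          (pochhammerSymbol 1 k ^ 2 /
            (pochhammerSymbol (1 / 4) k * pochhammerSymbol (3 / 4) k))))) ∧
    Tendsto
      (fun N : ℕ => ∑ n ∈ Finset.range N,
        (-1 : ℂ) ^ n * (risingFactorial (1 / 2) n ^ 3 / risingFactorial 1 n ^ 3) *
          (4 * (n : ℂ) + 1))
      atTop
      (𝓝 (2 / (Real.pi : ℂ))) := by
  refine and_iff_left_of_imp (fun H => ?_) |>.2 ?_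
  · convert H 0 (by norm_num) using 2
    · refine Finset.sum_congr rfl fun n _ => ?_
      rw [sub_zero, add_zero]
      ring
    · have h1 : Complex.Gamma (1 / 4) ≠ 0 := Complex.Gamma_ne_zero_of_re_pos (by norm_num)
      have h2 : Complex.Gamma (3 / 4) ≠ 0 := Complex.Gamma_ne_zero_of_re_pos (by norm_num)
      simp only [pochhammerSymbol, add_zero, Complex.Gamma_one, Complex.cpow_zero]
      rw [div_self h1, div_self h2]
      norm_num
  · intro k hk
    have e : 1 + 1 / 2 - (1 / 2 - k) = 1 + k := by ring
    have hy : ∀ j : ℕ, 1 + 1 / 2 - (1 / 2 - k) ≠ -j := by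
      rw [e]
      apply ne_neg_natCast_of_re_pos
      simp only [Complex.add_re, Complex.one_re]
      linarith
    have h := (tendsto_sum_alternating_wellPoised (a := 1 / 2) (b := 1 / 2 - k) (c := 1 / 2 - k)
      (by norm_num) hy hy (by simp; linarith)).const_mul 2
    rw [← gamma_quotient_eq hk]
    convert h using 2
    · rw [Finset.mul_sum]
      refine Finset.sum_congr rfl fun n _ => ?_
      rw [wellPoised, e, risingFactorial_one]
      ring
    · rw [e, show (1 + k - (1 / 2 - k) : ℂ) = 1 / 2 + 2 * k by ring,
        show (1 + 1 / 2 : ℂ) = 3 / 2 by norm_num]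
      ring
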